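/- All topological spaces are Tychonoff (completely regular $T_1$) and non-empty, and all topological groups are Hausdorff. For a space $X$ and a topological group $G$ with identity $e$, let $C_p(X,G)$ be the group of all continuous maps $X\to G$ with pointwise multiplication and the topology of pointwise convergence. The space $X$ is *$G^\star$-regular* if there is $g\in G\setminus\{e\}$ such that for every closed $F\subseteq X$ and every $x\in X\setminus F$ there is $f\in C_p(X,G)$ with $f(x)=g$ and $f(F)\subseteq\{e\}$. Spaces $X$ and $Y$ are *$G$-equivalent* if $C_p(X,G)$ and $C_p(Y,G)$ are topologically isomorphic. $G$ is *NSS* if some open neighbourhood of $e$ contains no non-trivial subgroup of $G$. A subset $A$ of a topological group $H$ is *absolutely productive* if for every injection $a:\mathbb N\to A$ and every $z:\mathbb N\to\mathbb Z$ the sequence $\prod_{n=0}^k a(n)^{z(n)}$ $(k\in\mathbb N)$ converges in $H$; $H$ is *TAP* if all its absolutely productive subsets are finite. The tightness $t(Z)$ is the least infinite cardinal $\kappa$ such that whenever $z\in\overline A\subseteq Z$ there is $B\subseteq A$ with $|B|\le\kappa$ and $z\in\overline B$ ($Z$ has countable tightness if $t(Z)\le\aleph_0$); $l(Z)$ is the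 least infinite cardinal $\kappa$ such that every open cover of $Z$ has a subcover of cardinality at most $\kappa$; and $l^*(X)=\sup\{l(X^n):n\in\mathbb N\}$. **Theorem.** Let $G$ be a metrizable topological group and let $X$ be a $G^\star$-regular space. Then: 1. $l^*(X)=t(C_p(X,G))$. 2. If $G$ is NSS, then $X$ is compact if and only if $C_p(X,G)$ is a TAP group of countable tightness. 3. If $G$ is NSS, $X$ is compact, and $Y$ is a $G^\star$-regular space that is $G$-equivalent to $X$, then $Y$ is compact. -/

import Mathlib

open Filter Topology Cardinal

universe u v w

/-- `C_p(X, G)`: the group of continuous maps `X → G` under pointwise multiplication, with the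
topology of pointwise convergence (the subspace topology inherited from the product `X → G`). -/
abbrev Cp (X : Type u) (G : Type v) [TopologicalSpace X] [Group G] [TopologicalSpace G]
    [IsTopologicalGroup G] : Type (max u v) :=
  continuousSubgroup X G

/-- `X` is `G⋆`-regular: one element `g ≠ 1` serves all pairs of a closed set and a point
outside of it. -/
def IsGStarRegular (X : Type u) (G : Type v) [TopologicalSpace X] [Group G] [TopologicalSpace G]
    [IsTopologicalGroup G] : Prop :=
  ∃ g : G, g ≠ 1 ∧ ∀ (F : Set X) (x : X), IsClosed F → x ∉ F →
    ∃ f : Cp X G, f.1 x = g ∧ ∀ y ∈ F, f.1 y = 1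

/-- Two spaces are `G`-equivalent if their groups `C_p` are topologically isomorphic. -/
def IsGEquivalent (X : Type u) (Y : Type w) (G : Type v) [TopologicalSpace X] [TopologicalSpace Y]
    [Group G] [TopologicalSpace G] [IsTopologicalGroup G] : Prop :=
  Nonempty (Cp X G ≃ₜ* Cp Y G)

/-- `G` has no small subgroups. -/
def IsNSS (G : Type u) [Group G] [TopologicalSpace G] : Prop :=
  ∃ U : Set G, IsOpen U ∧ 1 ∈ U ∧ ∀ H : Subgroup G, (H : Set G) ⊆ U → H = ⊥

/-- `A` is absolutely productive: for every injection `a : ℕ → A` and all `z : ℕ → ℤ`, the ordered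
partial products `a 0 ^ z 0 * ⋯ * a k ^ z k` converge in `G`. -/
def IsAbsolutelyProductive {G : Type u} [Group G] [TopologicalSpace G] (A : Set G) : Prop :=
  ∀ a : ℕ → G, Function.Injective a → (∀ n, a n ∈ A) → ∀ z : ℕ → ℤ,
    ∃ g : G, Tendsto (fun k : ℕ => ((List.range (k + 1)).map fun n => a n ^ z n).prod)
      atTop (𝓝 g)

/-- `G` is TAP (trivially absolutely productive). -/
def IsTAP (G : Type u) [Group G] [TopologicalSpace G] : Prop :=
  ∀ A : Set G, IsAbsolutelyProductive A → A.Finite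

/-- The tightness `t(X)`; as usual for cardinal functions, it is infinite by convention. -/
noncomputable def tightness (X : Type u) [TopologicalSpace X] : Cardinal.{u} :=
  sInf {κ : Cardinal.{u} | ℵ₀ ≤ κ ∧
    ∀ (A : Set X) (x : X), x ∈ closure A → ∃ B ⊆ A, #B ≤ κ ∧ x ∈ closure B}

/-- The Lindelöf number `l(X)`; it is infinite by convention. -/
noncomputable def lindelofNumber (X : Type u) [TopologicalSpace X] : Cardinal.{u} :=
  sInf {κ : Cardinal.{u} | ℵ₀ ≤ κ ∧
    ∀ 𝒱 : Set (Set X), (∀ V ∈ 𝒱, IsOpen V) → ⋃₀ 𝒱 = Set.univ →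
      ∃ 𝒲 ⊆ 𝒱, #𝒲 ≤ κ ∧ ⋃₀ 𝒲 = Set.univ}

/-- `l*(X) = sup {l(Xⁿ) : n ∈ ℕ}`. -/
noncomputable def lStar (X : Type u) [TopologicalSpace X] : Cardinal.{u} :=
  ⨆ n : ℕ, lindelofNumber (Fin n → X)

/-! A basic neighbourhood in `Cp X G` constrains a function at finitely many points, that is, along
a point of `Fin n → X`, which links tightness of `Cp X G` to covers of finite powers of `X`. If f
lies in the closure of A, the members of A that are U-close to f along tuples yield open covers of
each power. Subcovers, collected over n and a countable base at 1, give the small subset of A.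
Conversely, an open cover of the n-th power determines a set of functions supported in finite unions
of sets whose boxes refine it. The constant g is in its closure, and a small subset with g still in
the closure reads off a small subcover. If X is compact and G is NSS, an infinite absolutely
productive set would give a product whose limit is 1 at a cluster point of points where it stays
away from 1. If X is Lindelöf but not compact, functions supported in a locally finite sequence of
open sets violate TAP. Both properties on the `Cp` side survive topological isomorphism, which gives
the last claim. -/

/-! ### Closures in the topology of pointwise convergence -/

section Closure

variable {X : Type u} {G : Type v} [TopologicalSpace X] [Group G] [TopologicalSpace G]
  [IsTopologicalGroup G]

/-- Translation by the inverse of f (p i) moves each coordinate neighbourhood to the identity, where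
finitely many of them intersect in a single U. -/
theorem Cp.mem_closure_iff {B : Set (Cp X G)} {f : Cp X G} :
    f ∈ closure B ↔ ∀ U ∈ 𝓝 (1 : G), ∀ (n : ℕ) (p : Fin n → X),
      ∃ b ∈ B, ∀ i, (f.1 (p i))⁻¹ * b.1 (p i) ∈ U := by
  rw [mem_closure_iff_nhds]
  constructor
  · intro h U hU n p
    have hN : {b : Cp X G | ∀ i, (f.1 (p i))⁻¹ * b.1 (p i) ∈ U} ∈ 𝓝 f := by
      change ∀ᶠ b : Cp X G in 𝓝 f, ∀ i, (f.1 (p i))⁻¹ * b.1 (p i) ∈ U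
      refine eventually_all.2 fun i => ?_
      have hc : Continuous fun b : Cp X G => (f.1 (p i))⁻¹ * b.1 (p i) :=
        continuous_const.mul ((continuous_apply (p i)).comp continuous_subtype_val)
      exact hc.continuousAt.eventually (by simpa using hU)
    obtain ⟨b, hb, hbB⟩ := h _ hN
    exact ⟨b, hbB, hb⟩
  · intro h N hN
    rw [nhds_subtype, mem_comap] at hN
    obtain ⟨M, hM, hMN⟩ := hN
    rw [nhds_pi, Filter.mem_pi] at hM
    obtain ⟨I, hI, t, ht, htM⟩ := hM
    have hU : (⋂ i ∈ I, (fun y => f.1 i * y) ⁻¹' t i) ∈ 𝓝 (1 : G) := by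
      refine (biInter_mem hI).2 fun i _ => ?_
      refine (continuous_const.mul continuous_id).continuousAt.preimage_mem_nhds ?_
      simpa using ht i
    lift I to Finset X using hI
    obtain ⟨b, hb, hbU⟩ := h _ hU _ (fun i => (I.equivFin.symm i : X))
    refine ⟨b, hMN (htM fun x hx => ?_), hb⟩
    have := Set.mem_iInter₂.1 (hbU (I.equivFin ⟨x, hx⟩)) x hx
    simpa using this

end Closure

/-! ### Tightness and Lindelöf numbers -/

section CardinalFunctions

theorem tightness_spec (Z : Type u) [TopologicalSpace Z] : ℵ₀ ≤ tightness Z ∧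
    ∀ (A : Set Z) (x : Z), x ∈ closure A → ∃ B ⊆ A, #B ≤ tightness Z ∧ x ∈ closure B :=
  csInf_mem (s := {κ : Cardinal.{u} | ℵ₀ ≤ κ ∧
    ∀ (A : Set Z) (x : Z), x ∈ closure A → ∃ B ⊆ A, #B ≤ κ ∧ x ∈ closure B})
    ⟨max ℵ₀ #Z, le_max_left _ _, fun A _ hx =>
      ⟨A, subset_rfl, (mk_set_le A).trans (le_max_right _ _), hx⟩⟩

theorem tightness_le {Z : Type u} [TopologicalSpace Z] {κ : Cardinal.{u}} (hκ : ℵ₀ ≤ κ)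
    (h : ∀ (A : Set Z) (x : Z), x ∈ closure A → ∃ B ⊆ A, #B ≤ κ ∧ x ∈ closure B) :
    tightness Z ≤ κ :=
  csInf_le' ⟨hκ, h⟩

theorem tightness_le_aleph0_iff {Z : Type u} [TopologicalSpace Z] : tightness Z ≤ ℵ₀ ↔
    ∀ (A : Set Z) (x : Z), x ∈ closure A → ∃ B ⊆ A, B.Countable ∧ x ∈ closure B := by
  constructor
  · intro h A x hx
    obtain ⟨B, hBA, hB, hxB⟩ := (tightness_spec Z).2 A x hx
    exact ⟨B, hBA, le_aleph0_iff_set_countable.1 (hB.trans h), hxB⟩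
  · intro h
    refine tightness_le le_rfl fun A x hx => ?_
    obtain ⟨B, hBA, hB, hxB⟩ := h A x hx
    exact ⟨B, hBA, le_aleph0_iff_set_countable.2 hB, hxB⟩

/-- Countability is universe-independent, whereas the two tightness cardinals may live in different
universes. -/
theorem Homeomorph.tightness_le_aleph0 {Z : Type u} {Z' : Type w} [TopologicalSpace Z]
    [TopologicalSpace Z'] (e : Z ≃ₜ Z') (h : tightness Z ≤ ℵ₀) : tightness Z' ≤ ℵ₀ := by
  rw [tightness_le_aleph0_iff] at h ⊢
  intro A x hx
  have hx' : e.symm x ∈ closure (e ⁻¹' A) := by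
    rw [← e.preimage_closure]
    simpa using hx
  obtain ⟨B, hBA, hB, hxB⟩ := h _ _ hx'
  refine ⟨e '' B, Set.image_subset_iff.2 hBA, hB.image e, ?_⟩
  rw [← e.image_closure]
  exact ⟨_, hxB, by simp⟩

theorem lindelofNumber_spec (Z : Type u) [TopologicalSpace Z] : ℵ₀ ≤ lindelofNumber Z ∧
    ∀ 𝒱 : Set (Set Z), (∀ V ∈ 𝒱, IsOpen V) → ⋃₀ 𝒱 = Set.univ →
      ∃ 𝒲 ⊆ 𝒱, #𝒲 ≤ lindelofNumber Z ∧ ⋃₀ 𝒲 = Set.univ :=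
  csInf_mem (s := {κ : Cardinal.{u} | ℵ₀ ≤ κ ∧
    ∀ 𝒱 : Set (Set Z), (∀ V ∈ 𝒱, IsOpen V) → ⋃₀ 𝒱 = Set.univ →
      ∃ 𝒲 ⊆ 𝒱, #𝒲 ≤ κ ∧ ⋃₀ 𝒲 = Set.univ})
    ⟨max ℵ₀ #(Set Z), le_max_left _ _, fun 𝒱 _ h =>
      ⟨𝒱, subset_rfl, (mk_set_le 𝒱).trans (le_max_right _ _), h⟩⟩

theorem lindelofNumber_le {Z : Type u} [TopologicalSpace Z] {κ : Cardinal.{u}} (hκ : ℵ₀ ≤ κ)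
    (h : ∀ 𝒱 : Set (Set Z), (∀ V ∈ 𝒱, IsOpen V) → ⋃₀ 𝒱 = Set.univ →
      ∃ 𝒲 ⊆ 𝒱, #𝒲 ≤ κ ∧ ⋃₀ 𝒲 = Set.univ) :
    lindelofNumber Z ≤ κ :=
  csInf_le' ⟨hκ, h⟩

theorem lift_lindelofNumber_le {Z : Type u} [TopologicalSpace Z] {κ : Cardinal.{max u v}}
    (hκ : ℵ₀ ≤ κ)
    (h : ∀ 𝒱 : Set (Set Z), (∀ V ∈ 𝒱, IsOpen V) → ⋃₀ 𝒱 = Set.univ →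
      ∃ 𝒲 ⊆ 𝒱, Cardinal.lift.{v} #𝒲 ≤ κ ∧ ⋃₀ 𝒲 = Set.univ) :
    Cardinal.lift.{v} (lindelofNumber Z) ≤ κ := by
  rcases le_total (Cardinal.lift.{v} (lindelofNumber Z)) κ with hle | hle
  · exact hle
  -- A cardinal below a lift is itself a lift, so the comparison descends to the universe of Z.
  · obtain ⟨κ', rfl⟩ := Cardinal.mem_range_lift_of_le hle
    simp only [Cardinal.lift_le, Cardinal.aleph0_le_lift] at *
    exact lindelofNumber_le hκ h

/-- Indexed form of the covering property of the Lindelöf number. -/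
theorem exists_subcover_card_le_lindelofNumber {Z ι : Type u} [TopologicalSpace Z]
    (O : ι → Set Z) (hO : ∀ i, IsOpen (O i)) (hz : ∀ z, ∃ i, z ∈ O i) :
    ∃ s : Set ι, #s ≤ lindelofNumber Z ∧ ∀ z, ∃ i ∈ s, z ∈ O i := by
  obtain ⟨𝒲, h𝒲, hcard, hcov⟩ := (lindelofNumber_spec Z).2 (Set.range O)
    (by rintro _ ⟨i, rfl⟩; exact hO i)
    (Set.eq_univ_of_forall fun z => (hz z).elim fun i hi => ⟨O i, ⟨i, rfl⟩, hi⟩)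
  choose c hc using fun W : 𝒲 => h𝒲 W.2
  refine ⟨Set.range c, mk_range_le.trans hcard, fun z => ?_⟩
  obtain ⟨W, hW, hzW⟩ := (hcov ▸ Set.mem_univ z : z ∈ ⋃₀ 𝒲)
  exact ⟨c ⟨W, hW⟩, ⟨_, rfl⟩, by rw [hc]; exact hzW⟩

theorem lindelofNumber_eq_aleph0_of_compactSpace (Z : Type u) [TopologicalSpace Z]
    [CompactSpace Z] : lindelofNumber Z = ℵ₀ := by
  refine (lindelofNumber_le le_rfl fun 𝒱 h𝒱 hcov => ?_).antisymm (lindelofNumber_spec Z).1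
  obtain ⟨t, ht𝒱, ht, htc⟩ := isCompact_univ.elim_finite_subcover_image (b := 𝒱) (c := id) h𝒱
    (by simpa [Set.sUnion_eq_biUnion] using hcov.ge)
  refine ⟨t, ht𝒱, ht.lt_aleph0.le, Set.univ_subset_iff.1 ?_⟩
  simpa [Set.sUnion_eq_biUnion] using htc

theorem lindelofNumber_le_lStar (X : Type u) [TopologicalSpace X] (n : ℕ) :
    lindelofNumber (Fin n → X) ≤ lStar X :=
  le_ciSup (f := fun n : ℕ => lindelofNumber (Fin n → X)) (bddAbove_of_small) n

theorem lStar_eq_aleph0_of_compactSpace (X : Type u) [TopologicalSpace X] [CompactSpace X] :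
    lStar X = ℵ₀ := by
  simp [lStar, lindelofNumber_eq_aleph0_of_compactSpace]

end CardinalFunctions

/-! ### Tightness of `Cp X G` against the Lindelöf numbers of finite powers -/

section Tightness

variable {X : Type u} {G : Type v} [TopologicalSpace X] [Group G] [TopologicalSpace G]
  [IsTopologicalGroup G]

theorem tightness_Cp_le_lift_lStar [FirstCountableTopology G] :
    tightness (Cp X G) ≤ Cardinal.lift.{v} (lStar X) := by
  have hω : ℵ₀ ≤ lStar X := (lindelofNumber_spec _).1.trans (lindelofNumber_le_lStar X 0)
  refine tightness_le (by simpa using hω) fun A f hf => ?_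
  obtain ⟨U, hUo, hU⟩ := (nhds_basis_opens (1 : G)).exists_antitone_subbasis
  have key : ∀ m n : ℕ, ∃ (s : Set (Fin n → X)) (a : s → A), #s ≤ lStar X ∧
      ∀ p : Fin n → X, ∃ q, ∀ i, (f.1 (p i))⁻¹ * (a q).1.1 (p i) ∈ U m := by
    intro m n
    choose a haA ha using fun p : Fin n → X =>
      Cp.mem_closure_iff.1 hf (U m) ((hUo m).2.mem_nhds (hUo m).1) n p
    obtain ⟨s, hs, hcov⟩ := exists_subcover_card_le_lindelofNumber
      (fun p : Fin n → X => {q : Fin n → X | ∀ i, (f.1 (q i))⁻¹ * (a p).1 (q i) ∈ U m})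
      (fun p => by
        simp only [Set.ofPred_forall]
        refine isOpen_iInter_of_finite fun i => (hUo m).2.preimage ?_
        exact ((f.2.comp (continuous_apply i)).inv.mul ((a p).2.comp (continuous_apply i))))
      (fun p => ⟨p, ha p⟩)
    refine ⟨s, fun p => ⟨a p, haA p⟩, hs.trans (lindelofNumber_le_lStar X n), fun p => ?_⟩
    obtain ⟨y, hy, hyp⟩ := hcov p
    exact ⟨⟨y, hy⟩, hyp⟩
  choose s a hs ha using key
  refine ⟨Set.range fun r : Σ m n : ℕ, s m n => (a r.1 r.2.1 r.2.2 : Cp X G), ?_, ?_, ?_⟩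
  · rintro _ ⟨r, rfl⟩
    exact (a _ _ _).2
  · have h1 := mk_range_le_lift (f := fun r : Σ m n : ℕ, s m n => (a r.1 r.2.1 r.2.2 : Cp X G))
    have h2 : #(Σ m n : ℕ, s m n) ≤ lStar X := by
      simp only [mk_sigma]
      have : ∀ g : ℕ → Cardinal.{u}, (∀ i, g i ≤ lStar X) → Cardinal.sum g ≤ lStar X := by
        intro g hg
        refine (Cardinal.sum_le_sum _ _ hg).trans ?_
        simpa using Cardinal.mul_le_of_le hω hω le_rfl
      exact this _ fun m => this _ fun n => hs m n
    have h3 := Cardinal.lift_le.{max u v}.2 h2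
    rw [← Cardinal.lift_le.{u}]
    refine (h1.trans h3).trans ?_
    simp
  · refine Cp.mem_closure_iff.2 fun V hV n p => ?_
    obtain ⟨m, hm⟩ := hU.mem_iff.1 hV
    obtain ⟨q, hq⟩ := ha m n p
    exact ⟨_, ⟨⟨m, n, q⟩, rfl⟩, fun i => hm (hq i)⟩

/-- Induction on S with O arbitrary, so that O can be punctured at the new point a. One factor is
trivial at a and the other on S, hence their values never mix. -/
theorem exists_Cp_eq_on_finset [T1Space X] {g : G}
    (hg : ∀ (F : Set X) (x : X), IsClosed F → x ∉ F →
      ∃ f : Cp X G, f.1 x = g ∧ ∀ y ∈ F, f.1 y = 1)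
    (S : Finset X) : ∀ O : Set X, IsOpen O → (S : Set X) ⊆ O →
      ∃ f : Cp X G, (∀ x ∈ S, f.1 x = g) ∧ ∀ y ∉ O, f.1 y = 1 := by
  classical
  induction S using Finset.induction_on with
  | empty => exact fun O _ _ => ⟨1, by simp, fun _ _ => rfl⟩
  | insert a S ha ih =>
    intro O hO hSO
    obtain ⟨f, hfS, hfO⟩ := ih (O \ {a}) (hO.sdiff isClosed_singleton) fun x hx =>
      ⟨hSO (by simp [Finset.mem_coe.1 hx]), fun h => ha (Set.mem_singleton_iff.1 h ▸ hx)⟩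
    obtain ⟨h, hha, hhF⟩ := hg (Oᶜ ∪ S) a (hO.isClosed_compl.union S.finite_toSet.isClosed)
      (by simpa [ha] using hSO (Finset.mem_insert_self a S))
    refine ⟨f * h, fun x hx => ?_, fun y hy => ?_⟩
    · change f.1 x * h.1 x = g
      rcases Finset.mem_insert.1 hx with rfl | hx
      · rw [hfO x (by simp), hha, one_mul]
      · rw [hfS x hx, hhF x (Or.inr hx), mul_one]
    · change f.1 y * h.1 y = 1
      rw [hfO y fun hy' => hy hy'.1, hhF y (Or.inl hy), one_mul]

/-- Finitely many points have open neighbourhoods all of whose `n`-fold products refine a given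
open cover of the `n`-th power. -/
theorem exists_open_nhds_pi_subset_cover {n k : ℕ} {𝒱 : Set (Set (Fin n → X))}
    (ho : ∀ V ∈ 𝒱, IsOpen V) (hc : ⋃₀ 𝒱 = Set.univ) (p : Fin k → X) :
    ∃ U : Fin k → Set X, (∀ j, IsOpen (U j)) ∧ (∀ j, p j ∈ U j) ∧
      ∀ q : Fin n → Fin k, ∃ V ∈ 𝒱, Set.pi Set.univ (fun i => U (q i)) ⊆ V := by
  have key : ∀ q : Fin n → Fin k, ∃ V ∈ 𝒱, ∃ O : Fin n → Set X,
      (∀ i, IsOpen (O i) ∧ p (q i) ∈ O i) ∧ Set.pi Set.univ O ⊆ V := by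
    intro q
    obtain ⟨V, hV, hqV⟩ := (hc ▸ Set.mem_univ _ : (fun i => p (q i)) ∈ ⋃₀ 𝒱)
    obtain ⟨O, hO, hOV⟩ := isOpen_pi_iff'.1 (ho V hV) _ hqV
    exact ⟨V, hV, O, hO, hOV⟩
  choose V hV O hO hOV using key
  refine ⟨fun j => ⋂ q, ⋂ i, ⋂ _ : q i = j, O q i, fun j => ?_, fun j => ?_, fun q => ?_⟩
  · exact isOpen_iInter_of_finite fun q => isOpen_iInter_of_finite fun i =>
      isOpen_iInter_of_finite fun _ => (hO q i).1
  · simp only [Set.mem_iInter]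
    rintro q i rfl
    exact (hO q i).2
  · refine ⟨V q, hV q, fun x hx => hOV q fun i _ => ?_⟩
    have := hx i trivial
    simp only [Set.mem_iInter] at this
    exact this q i rfl

theorem lift_lindelofNumber_pi_le_tightness_Cp [T1Space X] (hX : IsGStarRegular X G) [T1Space G]
    (n : ℕ) : Cardinal.lift.{v} (lindelofNumber (Fin n → X)) ≤ tightness (Cp X G) := by
  classical
  obtain ⟨hω, ht⟩ := tightness_spec (Cp X G)
  obtain ⟨g, hg1, hg⟩ := hX
  refine lift_lindelofNumber_le hω fun 𝒱 ho hc => ?_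
  -- Functions supported in a finite union of sets all of whose n-fold boxes lie in members of the
  -- cover.
  let A : Set (Cp X G) := {f | ∃ (k : ℕ) (U : Fin k → Set X),
    (∀ q : Fin n → Fin k, ∃ V ∈ 𝒱, Set.pi Set.univ (fun i => U (q i)) ⊆ V) ∧
      ∀ x, (∀ j, x ∉ U j) → f.1 x = 1}
  let c : Cp X G := ⟨fun _ => g, continuous_const⟩
  have hcA : c ∈ closure A := by
    refine Cp.mem_closure_iff.2 fun N hN k p => ?_
    obtain ⟨U, hUo, hpU, hU⟩ := exists_open_nhds_pi_subset_cover ho hc p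
    obtain ⟨f, hfp, hfU⟩ := exists_Cp_eq_on_finset hg (Finset.univ.image p) (⋃ j, U j)
      (isOpen_iUnion hUo) (by
        intro x hx
        obtain ⟨j, -, rfl⟩ := Finset.mem_image.1 (Finset.mem_coe.1 hx)
        exact Set.mem_iUnion.2 ⟨j, hpU j⟩)
    refine ⟨f, ⟨k, U, hU, fun x hx => hfU x (by simpa using hx)⟩, fun i => ?_⟩
    rw [hfp (p i) (by simp)]
    simpa [c] using mem_of_mem_nhds hN
  obtain ⟨B, hBA, hB, hcB⟩ := ht A c hcA
  choose k U hU hfU using fun f : B => hBA f.2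
  choose V hV hUV using hU
  refine ⟨Set.range fun r : Σ f : B, (Fin n → Fin (k f)) => V r.1 r.2, ?_, ?_, ?_⟩
  · rintro _ ⟨r, rfl⟩
    exact hV _ _
  · have h1 := mk_range_le_lift (f := fun r : Σ f : B, (Fin n → Fin (k f)) => V r.1 r.2)
    have h2 : #(Σ f : B, (Fin n → Fin (k f))) ≤ tightness (Cp X G) := by
      rw [mk_sigma]
      refine (Cardinal.sum_le_sum _ (fun _ => ℵ₀) fun f => mk_le_aleph0).trans ?_
      simpa using Cardinal.mul_le_of_le hω hB hω
    have h3 := Cardinal.lift_le.{u}.2 h2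
    rw [← Cardinal.lift_le.{u}]
    refine le_trans ?_ (h1.trans h3)
    simp
  · refine Set.eq_univ_of_forall fun x => ?_
    -- Avoiding the inverse of g means f (x i) ≠ 1, so every coordinate of x lies in the support
    -- sets of f.
    obtain ⟨f, hf, hfx⟩ := Cp.mem_closure_iff.1 hcB {g⁻¹}ᶜ
      (isOpen_compl_singleton.mem_nhds (by simpa [eq_comm] using hg1)) n x
    have hex : ∀ i, ∃ j, x i ∈ U ⟨f, hf⟩ j := by
      intro i
      by_contra! hcon
      have h1 : f.1 (x i) = 1 := hfU ⟨f, hf⟩ (x i) hcon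
      exact hfx i (by simp [c, h1])
    choose q hq using hex
    exact ⟨_, ⟨⟨⟨f, hf⟩, q⟩, rfl⟩, hUV _ _ fun i _ => hq i⟩

theorem lift_lStar_eq_tightness_Cp [T1Space X] [T1Space G] [FirstCountableTopology G]
    (hX : IsGStarRegular X G) : Cardinal.lift.{v} (lStar X) = tightness (Cp X G) := by
  refine le_antisymm ?_ tightness_Cp_le_lift_lStar
  rw [lStar, Cardinal.lift_iSup bddAbove_of_small]
  exact ciSup_le' fun n => lift_lindelofNumber_pi_le_tightness_Cp hX n

end Tightness

/-! ### The TAP property and compactness -/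

section TAP

theorem IsTAP.of_continuousMulEquiv {H : Type u} {K : Type v} [Group H] [TopologicalSpace H]
    [Group K] [TopologicalSpace K] (e : H ≃ₜ* K) (hH : IsTAP H) : IsTAP K := by
  intro A hA
  have : (e ⁻¹' A).Finite := by
    refine hH _ fun a ha haA z => ?_
    obtain ⟨g, hg⟩ := hA (fun n => e (a n)) (e.injective.comp ha) haA z
    refine ⟨e.symm g, ?_⟩
    have := (e.symm.continuous_toFun.tendsto g).comp hg
    refine this.congr fun k => ?_
    change e.symm (List.prod _) = _
    rw [map_list_prod, List.map_map]
    simp [Function.comp_def]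
  exact this.of_preimage e.surjective

theorem exists_zpow_notMem {G : Type u} [Group G] {U : Set G}
    (hU : ∀ H : Subgroup G, (H : Set G) ⊆ U → H = ⊥) {h : G} (hh : h ≠ 1) :
    ∃ c : ℤ, h ^ c ∉ U := by
  by_contra! hcon
  refine hh (Subgroup.zpowers_eq_bot.1 (hU _ ?_))
  rintro _ ⟨c, rfl⟩
  exact hcon c

/-- Each factor is the quotient of two consecutive partial products, which share a limit. -/
theorem prod_map_range_succ_tendsto_one {H : Type u} [Group H] [TopologicalSpace H]
    [IsTopologicalGroup H] {b : ℕ → H} {g : H}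
    (h : Tendsto (fun k : ℕ => ((List.range (k + 1)).map b).prod) atTop (𝓝 g)) :
    Tendsto b atTop (𝓝 1) := by
  have h2 := h.inv.mul ((tendsto_add_atTop_iff_nat 1).2 h)
  rw [inv_mul_cancel] at h2
  rw [← tendsto_add_atTop_iff_nat 1]
  refine h2.congr fun k => ?_
  rw [List.prod_range_succ _ (k + 1), inv_mul_cancel_left]

variable {X : Type u} {G : Type v} [TopologicalSpace X] [Group G] [TopologicalSpace G]
  [IsTopologicalGroup G]

theorem Cp.continuous_eval (x : X) : Continuous fun f : Cp X G => f.1 x :=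
  (continuous_apply x).comp continuous_subtype_val

/-- An absolutely productive sequence of maps into an NSS group is pointwise eventually trivial. -/
theorem IsAbsolutelyProductive.eventually_apply_eq_one (hG : IsNSS G) {A : Set (Cp X G)}
    (hA : IsAbsolutelyProductive A) {a : ℕ → Cp X G} (ha : Function.Injective a)
    (haA : ∀ n, a n ∈ A) (x : X) : ∀ᶠ n in atTop, (a n).1 x = 1 := by
  obtain ⟨U, hUo, hU1, hU⟩ := hG
  have hz : ∀ n, ∃ z : ℤ, (a n).1 x ≠ 1 → (a n).1 x ^ z ∉ U := by
    intro n
    by_cases h : (a n).1 x = 1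
    · exact ⟨0, fun h' => (h' h).elim⟩
    · obtain ⟨c, hc⟩ := exists_zpow_notMem hU h
      exact ⟨c, fun _ => hc⟩
  choose z hz using hz
  obtain ⟨g, hg⟩ := hA a ha haA z
  have h1 := ((Cp.continuous_eval x).tendsto 1).comp (prod_map_range_succ_tendsto_one hg)
  filter_upwards [h1.eventually (hUo.mem_nhds hU1)] with n hn
  by_contra h
  exact hz n h hn

theorem exists_triangular_sequence {A : Set (Cp X G)} (hA : A.Infinite)
    (h : ∀ a : ℕ → Cp X G, Function.Injective a → (∀ n, a n ∈ A) →
      ∀ x, ∀ᶠ n in atTop, (a n).1 x = 1) :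
    ∃ (b : ℕ → Cp X G) (y : ℕ → X), Function.Injective b ∧ (∀ n, b n ∈ A) ∧
      (∀ k, (b k).1 (y k) ≠ 1) ∧ ∀ k j, k < j → (b j).1 (y k) = 1 := by
  -- The identity is discarded so that every term is non-trivial at some point.
  let a := (hA.sdiff (Set.finite_singleton (1 : Cp X G))).natEmbedding
  have ha : Function.Injective fun n => (a n : Cp X G) :=
    Subtype.val_injective.comp a.injective
  have hx : ∀ n, ∃ x, (a n : Cp X G).1 x ≠ 1 := by
    intro n
    by_contra! hcon
    exact (a n).2.2 (Subtype.ext (funext hcon))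
  choose x hx using hx
  choose N hN using fun x => eventually_atTop.1 (h _ ha (fun n => (a n).2.1) x)
  -- The next index lies past the stage from which all terms are trivial at the point just chosen.
  let φ : ℕ → ℕ := fun k => Nat.rec 0 (fun _ m => max (m + 1) (N (x m))) k
  have hφ : ∀ k, φ (k + 1) = max (φ k + 1) (N (x (φ k))) := fun _ => rfl
  have hmono : StrictMono φ := strictMono_nat_of_lt_succ fun k => by
    rw [hφ]
    exact (Nat.lt_succ_self _).trans_le (le_max_left _ _)
  refine ⟨fun k => a (φ k), fun k => x (φ k), ha.comp hmono.injective, fun n => (a _).2.1,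
    fun k => hx _, fun k j hkj => hN _ _ ?_⟩
  exact ((le_max_right _ _).trans (hφ k).ge).trans (hmono.monotone hkj)

theorem isTAP_Cp_of_compactSpace [CompactSpace X] [T2Space G] (hG : IsNSS G) :
    IsTAP (Cp X G) := by
  intro A hA
  by_contra hinf
  have hev := fun a ha haA => hA.eventually_apply_eq_one hG (a := a) ha haA
  obtain ⟨b, y, hb, hbA, hby, hbj⟩ := exists_triangular_sequence hinf hev
  obtain ⟨x, -, hx⟩ := isCompact_univ.exists_mapClusterPt (u := y) (f := atTop) (by simp)
  obtain ⟨K, hK⟩ := eventually_atTop.1 (hev b hb hbA x)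
  obtain ⟨U, hUo, hU1, hU⟩ := hG
  obtain ⟨V, hVo, hV1, hVU⟩ : ∃ V : Set G, IsOpen V ∧ 1 ∈ V ∧ ∀ v ∈ V, ∀ w ∈ V, v⁻¹ * w ∈ U := by
    have hc : Continuous fun q : G × G => q.1⁻¹ * q.2 := continuous_fst.inv.mul continuous_snd
    have hn : (fun q : G × G => q.1⁻¹ * q.2) ⁻¹' U ∈ 𝓝 ((1 : G), (1 : G)) :=
      hc.continuousAt.preimage_mem_nhds (by simpa using hUo.mem_nhds hU1)
    obtain ⟨V, W, hVo, hV1, hW, h1W, hVW⟩ := mem_nhds_prod_iff'.1 hn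
    exact ⟨V ∩ W, hVo.inter hW, ⟨hV1, h1W⟩, fun v hv w hw =>
      hVW (Set.mk_mem_prod hv.1 hw.2)⟩
  -- If f (y k) times every power of b k (y k) lay in V, quotients would put all these powers in U,
  -- against NSS. Before K the exponent is 0, so the product never moves at x.
  have hc : ∀ (k : ℕ) (f : Cp X G), ∃ c : ℤ, (k < K → c = 0) ∧
      (K ≤ k → f.1 (y k) * (b k).1 (y k) ^ c ∉ V) := by
    intro k f
    rcases lt_or_ge k K with hk | hk
    · exact ⟨0, fun _ => rfl, fun h => (hk.not_ge h).elim⟩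
    · by_contra! hcon
      have hV : ∀ c : ℤ, f.1 (y k) * (b k).1 (y k) ^ c ∈ V := fun c =>
        (hcon c fun h => (h.not_ge hk).elim).2
      obtain ⟨c, hc⟩ := exists_zpow_notMem hU (hby k)
      refine hc ?_
      simpa using hVU _ (hV 0) _ (hV c)
  choose c hc0 hcV using hc
  let P : ℕ → Cp X G := fun k => Nat.rec 1 (fun k f => f * b k ^ c k f) k
  have hP : ∀ k, P (k + 1) = P k * b k ^ c k (P k) := fun _ => rfl
  have hPx : ∀ k z, (P (k + 1)).1 z = (P k).1 z * (b k).1 z ^ c k (P k) := fun _ _ => rfl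
  have hprod : ∀ k, ((List.range k).map fun n => b n ^ c n (P n)).prod = P k := by
    intro k
    induction k with
    | zero => rfl
    | succ k ih => rw [List.prod_range_succ, ih, hP]
  obtain ⟨l, hl⟩ := hA b hb hbA fun n => c n (P n)
  simp only [hprod] at hl
  have hlx : ∀ z m, (∀ k, m ≤ k → (P k).1 z = (P m).1 z) → l.1 z = (P m).1 z := by
    intro z m hm
    refine tendsto_nhds_unique (((Cp.continuous_eval z).tendsto l).comp hl) ?_
    refine tendsto_const_nhds.congr' ?_
    filter_upwards [eventually_ge_atTop m] with k hk
    exact (hm (k + 1) (by omega)).symm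
  have hl1 : l.1 x = 1 := by
    have h1 : ∀ k, (P k).1 x = 1 := by
      intro k
      induction k with
      | zero => rfl
      | succ k ih =>
        rw [hPx, ih]
        rcases lt_or_ge k K with hk | hk
        · simp [hc0 k _ hk]
        · simp [hK k hk]
    rw [hlx x 0 fun k _ => by rw [h1, h1], h1]
  -- Step k pushes the value at y k out of V, and by triangularity later factors leave it unchanged.
  have hly : ∀ k, K ≤ k → l.1 (y k) ∉ V := by
    intro k hk
    rw [hlx (y k) (k + 1), hPx]
    · exact hcV k _ hk
    · intro j hj
      induction j, hj using Nat.le_induction with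
      | base => rfl
      | succ j hj ih => rw [hPx, ih, hbj k j hj, one_zpow, mul_one]
  have hlV : l.1 ⁻¹' V ∈ 𝓝 x :=
    l.2.continuousAt.preimage_mem_nhds (by rw [hl1]; exact hVo.mem_nhds hV1)
  obtain ⟨k, hkV, hk⟩ := ((hx.frequently hlV).and_eventually (eventually_ge_atTop K)).exists
  exact hly k hk hkV

/-- Functions with locally finite supports form an absolutely productive set. -/
theorem isAbsolutelyProductive_range_of_locallyFinite {W : ℕ → Set X} (hW : LocallyFinite W)
    {f : ℕ → Cp X G} (hf : ∀ n, ∀ x ∉ W n, (f n).1 x = 1) :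
    IsAbsolutelyProductive (Set.range f) := by
  intro a ha haf z
  choose n hn using haf
  have hinj : Function.Injective n := fun i j hij => ha (by rw [← hn, ← hn, hij])
  let P : ℕ → Cp X G := fun k => ((List.range k).map fun i => a i ^ z i).prod
  have hP : ∀ k x, (P (k + 1)).1 x = (P k).1 x * (a k).1 x ^ z k := by
    intro k x
    simp only [P, List.prod_range_succ]
    rfl
  have key : ∀ x, ∃ O ∈ 𝓝 x, ∃ K, ∀ y ∈ O, ∀ k, K ≤ k → (P k).1 y = (P K).1 y := by
    intro x
    obtain ⟨O, hO, hfin⟩ := hW x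
    -- As `n` is injective, only finitely many of the a i have their W meeting O, so partial
    -- products stabilise uniformly on O.
    obtain ⟨K, hK⟩ := eventually_atTop.1
      ((hinj.tendsto_cofinite.eventually hfin.compl_mem_cofinite).filter_mono
        Nat.cofinite_eq_atTop.ge)
    refine ⟨O, hO, K, fun y hy k hk => ?_⟩
    induction k, hk using Nat.le_induction with
    | base => rfl
    | succ j hj ih =>
      have : (a j).1 y = 1 := by
        rw [← hn j]
        exact hf _ _ fun hyW => hK j hj ⟨y, hyW, hy⟩
      rw [hP, ih, this, one_zpow, mul_one]
  choose O hO K hK using key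
  have hl : ∀ x, ∀ y ∈ O x, (P (K y)).1 y = (P (K x)).1 y := by
    intro x y hy
    rw [← hK x y hy _ (le_max_left (K x) (K y)),
      hK y y (mem_of_mem_nhds (hO y)) _ (le_max_right _ _)]
  refine ⟨⟨fun x => (P (K x)).1 x, continuous_iff_continuousAt.2 fun x => ?_⟩, ?_⟩
  · refine ((P (K x)).2.continuousAt (x := x)).congr ?_
    filter_upwards [hO x] with y hy
    exact (hl x y hy).symm
  · rw [tendsto_subtype_rng, tendsto_pi_nhds]
    intro x
    refine tendsto_const_nhds.congr' ?_
    filter_upwards [eventually_ge_atTop (K x)] with k hk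
    exact (hK x x (mem_of_mem_nhds (hO x)) (k + 1) (by omega)).symm

theorem not_isTAP_Cp_of_locallyFinite (hX : IsGStarRegular X G) {W : ℕ → Set X}
    (hW : LocallyFinite W) (hWo : ∀ n, IsOpen (W n)) (hWn : ∀ n, (W n).Nonempty) :
    ¬ IsTAP (Cp X G) := by
  intro hT
  obtain ⟨g, hg1, hg⟩ := hX
  choose x hx using hWn
  choose f hfx hf using fun n => hg (W n)ᶜ (x n) (hWo n).isClosed_compl (by simpa using hx n)
  have hfin := hT _ (isAbsolutelyProductive_range_of_locallyFinite hW hf)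
  have := hfin.to_subtype
  -- A finite range would make f n = f m for infinitely many n, putting x m into infinitely many W
  -- n.
  obtain ⟨⟨_, m, rfl⟩, hm⟩ := Finite.exists_infinite_fiber (Set.rangeFactorization f)
  refine (Set.infinite_coe_iff.1 hm) ((hW.point_finite (x m)).subset fun n hn => ?_)
  have hnm : f n = f m := congrArg Subtype.val hn
  by_contra hxn
  exact hg1 (by rw [← hfx m, ← hnm, hf n _ hxn])

/-- A non-compact regular space in which open covers have countable subcovers carries an infinite
locally finite sequence of nonempty open sets. -/
theorem exists_locallyFinite_of_not_compactSpace [RegularSpace X] [LindelofSpace X]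
    (hX : ¬ CompactSpace X) : ∃ W : ℕ → Set X, LocallyFinite W ∧ (∀ n, IsOpen (W n)) ∧
      ∀ n, (W n).Nonempty := by
  have : ∃ (ι : Type u) (V : ι → Set X), (∀ i, IsOpen (V i)) ∧ (⋃ i, V i) = Set.univ ∧
      ∀ t : Finset ι, (⋃ i ∈ t, V i) ≠ Set.univ := by
    by_contra! hcon
    refine hX ⟨isCompact_of_finite_subcover fun {ι} V hV hc => ?_⟩
    obtain ⟨t, ht⟩ := hcon ι V hV (Set.univ_subset_iff.1 hc)
    exact ⟨t, ht.ge⟩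
  obtain ⟨ι, V, hV, hc, ht⟩ := this
  have hN : ∀ x, ∃ (i : ι) (N : Set X), IsOpen N ∧ x ∈ N ∧ closure N ⊆ V i := by
    intro x
    obtain ⟨i, hi⟩ := Set.mem_iUnion.1 (hc ▸ Set.mem_univ x : x ∈ ⋃ i, V i)
    obtain ⟨C, hC, hCc, hCV⟩ := exists_mem_nhds_isClosed_subset ((hV i).mem_nhds hi)
    exact ⟨i, interior C, isOpen_interior, mem_interior_iff_mem_nhds.2 hC,
      (closure_minimal interior_subset hCc).trans hCV⟩
  choose i N hNo hxN hNV using hN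
  have : Nonempty X := by
    by_contra hE
    rw [not_nonempty_iff] at hE
    exact hX inferInstance
  obtain ⟨x, hx⟩ := isLindelof_univ.indexed_countable_subcover N hNo
    fun x _ => Set.mem_iUnion.2 ⟨x, hxN x⟩
  -- The neighbourhood N (x m) misses every W n with n > m. An empty W n would make finitely many of
  -- the V i cover X.
  refine ⟨fun n => (⋃ k ∈ Finset.range n, closure (N (x k)))ᶜ, fun y => ?_, fun n => ?_,
    fun n => ?_⟩
  · obtain ⟨m, hm⟩ := Set.mem_iUnion.1 (hx (Set.mem_univ y))
    refine ⟨N (x m), (hNo _).mem_nhds hm, (Set.finite_Iic m).subset ?_⟩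
    rintro n ⟨z, hz, hzN⟩
    by_contra hnm
    exact hz (Set.mem_biUnion (Finset.mem_coe.2 (Finset.mem_range.2 (not_le.1 hnm)))
      (subset_closure hzN))
  · exact ((Finset.range n).finite_toSet.isClosed_biUnion fun _ _ => isClosed_closure).isOpen_compl
  · classical
    rw [Set.nonempty_compl]
    intro hu
    refine ht ((Finset.range n).image fun k => i (x k)) (Set.univ_subset_iff.1 ?_)
    rw [← hu]
    refine Set.iUnion₂_subset fun k hk => (hNV (x k)).trans ?_
    exact Set.subset_biUnion_of_mem (u := V) (Finset.mem_coe.2 (Finset.mem_image_of_mem _ hk))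

theorem lindelofSpace_of_tightness_Cp_le_aleph0 [T1Space X] [T1Space G]
    (hX : IsGStarRegular X G) (h : tightness (Cp X G) ≤ ℵ₀) : LindelofSpace X := by
  -- Only the first power is needed here.
  have hl : lindelofNumber (Fin 1 → X) ≤ ℵ₀ := by
    simpa using (lift_lindelofNumber_pi_le_tightness_Cp hX 1).trans h
  have hL : IsLindelof (Set.univ : Set (Fin 1 → X)) := by
    refine isLindelof_of_countable_subcover fun {ι} U hU hc => ?_
    obtain ⟨t, ht, htc⟩ := exists_subcover_card_le_lindelofNumber U hU
      fun z => Set.mem_iUnion.1 (hc (Set.mem_univ z))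
    refine ⟨t, le_aleph0_iff_set_countable.1 (ht.trans hl), fun z _ => ?_⟩
    obtain ⟨i, hi, hzi⟩ := htc z
    exact Set.mem_biUnion hi hzi
  refine ⟨?_⟩
  have := hL.image (continuous_apply (0 : Fin 1))
  rwa [Set.image_univ, Set.range_eq_univ.2 fun x => ⟨fun _ => x, rfl⟩] at this

theorem compactSpace_of_isTAP_Cp [T1Space X] [RegularSpace X] [T1Space G]
    (hX : IsGStarRegular X G) (hT : IsTAP (Cp X G)) (ht : tightness (Cp X G) ≤ ℵ₀) :
    CompactSpace X := by
  have := lindelofSpace_of_tightness_Cp_le_aleph0 hX ht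
  by_contra hcon
  obtain ⟨W, hW, hWo, hWn⟩ := exists_locallyFinite_of_not_compactSpace hcon
  exact not_isTAP_Cp_of_locallyFinite hX hW hWo hWn hT

end TAP

/-! ### Assembly and invariance under G-equivalence -/

theorem mainTheorem2 {G : Type v} [Group G] [TopologicalSpace G] [IsTopologicalGroup G]
    [TopologicalSpace.MetrizableSpace G]
    {X : Type u} [TopologicalSpace X] [T35Space X] [Nonempty X] (hX : IsGStarRegular X G) :
    Cardinal.lift.{v} (lStar X) = tightness (Cp X G) ∧
    (IsNSS G →
      (CompactSpace X ↔ IsTAP (Cp X G) ∧ tightness (Cp X G) ≤ ℵ₀) ∧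
      ∀ (Y : Type w) [TopologicalSpace Y] [T35Space Y] [Nonempty Y], IsGStarRegular Y G →
        IsGEquivalent X Y G → CompactSpace X → CompactSpace Y) := by
  let := TopologicalSpace.metrizableSpaceMetric G
  have h1 := lift_lStar_eq_tightness_Cp hX
  have h2 : IsNSS G → CompactSpace X → IsTAP (Cp X G) ∧ tightness (Cp X G) ≤ ℵ₀ := by
    intro hG _
    refine ⟨isTAP_Cp_of_compactSpace hG, ?_⟩
    rw [← h1, lStar_eq_aleph0_of_compactSpace, Cardinal.lift_aleph0]
  refine ⟨h1, fun hG => ⟨⟨h2 hG, fun h => compactSpace_of_isTAP_Cp hX h.1 h.2⟩, ?_⟩⟩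
  rintro Y _ _ _ hY ⟨e⟩ hXc
  obtain ⟨hT, ht⟩ := h2 hG hXc
  exact compactSpace_of_isTAP_Cp hY (hT.of_continuousMulEquiv e)
    (e.toHomeomorph.tightness_le_aleph0 ht)
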